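/- Let $k$ be a field of characteristic $\neq 2,3$. Let $V_+,V_-$ be $3$-dimensional $k$-vector spaces, $V=V_+\oplus V_-$, $V'=\mathrm{Sym}^2(V_+^\vee)\oplus \mathrm{Sym}^2(V_-^\vee)$, and let $\iota$ be the involution that is $+1$ on $V_+$ and $-1$ on $V_-$ (and the induced involution of $V^\vee$). Write $\mathbb P(\cdot)$ for the space of lines. Let $Z\to\mathbb P(V_+)\times\mathbb P(V_-)$ be the $\mathbb P^1$-bundle of lines in $\mathcal O(-2,0)\oplus\mathcal O(0,-2)$, so that $H^0(Z,\mathcal O_Z(1))=V'$. Let $B,C,D$ be $k$-curves isomorphic to $\mathbb P^1_k$, and let $g:D\to C$ and $f:C\to B$ be separable $k$-morphisms of degrees $2$ and $3$ such that the Galois group of the Galois closure of $k(D)/k(B)$ is the full wreath product $(\mathfrak S_2)^3\rtimes\mathfrak S_3$. Let $\iota_D$ be the nontrivial involution of $D$ over $C$, and let $j:D\to\mathbb P(V^\vee)$ be a closed immersion, equivariant for $\iota_D$ and $\iota$, whose image is a rational normal curve of degree $5$; equivalently, $j$ is given by an isomorphism $V\cong H^0(D,\mathcal O_D(5))$. Put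 $K=k(B)$. Let $J\in V^\vee\otimes k(D)$ be a linear form representing the generic point of $j$, and let $Q=\mathrm{Nm}_{k(D)/k(C)}(J)\in \mathrm{Sym}^2(V^\vee)\otimes k(C)$ be its norm; by equivariance $Q\in V'\otimes k(C)$. Let $W\subset V'\otimes K$ be the $3$-dimensional subspace $\{(\mathrm{id}\otimes\lambda)(Q):\lambda\in\mathrm{Hom}_K(k(C),K)\}$, which is the generic point of a morphism $h:B\to\mathrm{Grass}(3,V')$. Let $\pi_h:\mathcal X_h\to B$, $\mathcal X_h\subset B\times Z$, be the pullback by $h$ of the universal family of intersections of three divisors in $|\mathcal O_Z(1)|$, so that its generic fibre $\mathcal X_{h,K}\subset Z_K$ is the common zero locus of the sections in $W$. Then every irreducible multi-section of $\pi_h$ (equivalently, every closed point $x$ of $\mathcal X_{h,K}$, with degree $[\kappa(x):K]$) has degree divisible by $3$ or by $4$. Moreover $$M(K,\mathcal X_{h,K}):=\min\{[L:K] : L/K \text{ a finite extension with } \mathcal X_{h,K}(L)\neq\emptyset\}=3 .$$ -/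

import Mathlib

universe u

namespace EnriquesPencil

open MvPolynomial

/-- Coordinates on `V = V₊ ⊕ V₋`: `Sum.inl` indexes a basis of `V₊^∨`, `Sum.inr` one of `V₋^∨`. -/
abbrev Idx : Type := Fin 3 ⊕ Fin 3

/-- The full wreath product `(𝔖₂)³ ⋊ 𝔖₃`, where `𝔖₃` permutes the three factors. -/
abbrev WreathProduct : Type :=
  (Fin 3 → Equiv.Perm (Fin 2)) ⋊[mulAutArrow] Equiv.Perm (Fin 3)

/-! ### The projective bundle `Z` over `ℙ(V₊) × ℙ(V₋)` -/

/-- Homogeneous coordinates of an `L`-point of the projective bundle `Z` of lines in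
`𝒪(-2, 0) ⊕ 𝒪(0, -2)` over `ℙ(V₊) × ℙ(V₋)`: the point is the pair of lines
`(L · xp, L · xm)` together with the line spanned by `s • xp ⊗ xp + t • xm ⊗ xm`. -/
structure ZCoord (L : Type u) [Field L] where
  xp : Fin 3 → L
  xm : Fin 3 → L
  s : L
  t : L
  xp_ne : xp ≠ 0
  xm_ne : xm ≠ 0
  st_ne : s ≠ 0 ∨ t ≠ 0

/-- Two coordinate vectors give the same point of `Z`: rescaling `xp` by `a` rescales
`xp ⊗ xp` by `a²`, and the vector of the third line may be rescaled by `c`. -/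
def ZCoord.Rel {L : Type u} [Field L] (x y : ZCoord L) : Prop :=
  ∃ a b c : L, a ≠ 0 ∧ b ≠ 0 ∧ c ≠ 0 ∧ y.xp = a • x.xp ∧ y.xm = b • x.xm ∧
    a ^ 2 * y.s = c * x.s ∧ b ^ 2 * y.t = c * x.t

instance ZCoord.setoid (L : Type u) [Field L] : Setoid (ZCoord L) where
  r := ZCoord.Rel
  iseqv :=
    { refl := fun x => ⟨1, 1, 1, one_ne_zero, one_ne_zero, one_ne_zero, by simp⟩
      symm := by
        rintro x y ⟨a, b, c, ha, hb, hc, h1, h2, h3, h4⟩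
        refine ⟨a⁻¹, b⁻¹, c⁻¹, inv_ne_zero ha, inv_ne_zero hb, inv_ne_zero hc, ?_, ?_, ?_, ?_⟩
        · rw [h1, smul_smul, inv_mul_cancel₀ ha, one_smul]
        · rw [h2, smul_smul, inv_mul_cancel₀ hb, one_smul]
        · field_simp
          linear_combination -h3
        · field_simp
          linear_combination -h4
      trans := by
        rintro x y z ⟨a, b, c, ha, hb, hc, h1, h2, h3, h4⟩ ⟨a', b', c', ha', hb', hc', h1', h2', h3', h4'⟩
        refine ⟨a' * a, b' * b, c' * c, mul_ne_zero ha' ha, mul_ne_zero hb' hb,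
          mul_ne_zero hc' hc, ?_, ?_, ?_, ?_⟩
        · rw [h1', h1, smul_smul]
        · rw [h2', h2, smul_smul]
        · linear_combination a ^ 2 * h3' + c' * h3
        · linear_combination b ^ 2 * h4' + c' * h4 }

/-- The set `Z(L)` of `L`-points of `Z`. -/
def ZPoint (L : Type u) [Field L] : Type u := Quotient (ZCoord.setoid L)

/-- Extension of scalars on coordinates. -/
def ZCoord.map {F L : Type u} [Field F] [Field L] (φ : F →+* L) (x : ZCoord F) : ZCoord L where
  xp := fun i => φ (x.xp i)
  xm := fun i => φ (x.xm i)
  s := φ x.s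
  t := φ x.t
  xp_ne := fun h => x.xp_ne (funext fun i => φ.injective (by simpa using congrFun h i))
  xm_ne := fun h => x.xm_ne (funext fun i => φ.injective (by simpa using congrFun h i))
  st_ne := by simpa using x.st_ne

/-- The map `Z(F) → Z(L)` induced by a homomorphism of fields `F → L`. -/
def ZPoint.map {F L : Type u} [Field F] [Field L] (φ : F →+* L) : ZPoint F → ZPoint L :=
  Quotient.map (ZCoord.map φ) (by
    rintro x y ⟨a, b, c, ha, hb, hc, h1, h2, h3, h4⟩
    refine ⟨φ a, φ b, φ c, by simpa, by simpa, by simpa, ?_, ?_, ?_, ?_⟩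
    · funext i; simp [ZCoord.map, h1]
    · funext i; simp [ZCoord.map, h2]
    · simpa [ZCoord.map] using congrArg φ h3
    · simpa [ZCoord.map] using congrArg φ h4)

/-! ### The pencil of nets of quadrics -/

section Net

variable {k : Type u} [Field k]

/-- The rational normal curve `j : D → ℙ(V^∨)`, given by the basis `P` of `H⁰(D, 𝒪(5))`: the linear
form `∑ i, P i (z) · X i` over `k(D)`, where `z` is the affine coordinate of `D = ℙ¹`.
It is the equation of the hyperplane of `ℙ(V)` corresponding to the generic point of `j`. -/
noncomputable def linearForm {KD : Type u} [Field KD] [Algebra k KD]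
    (zD : RatFunc k ≃ₐ[k] KD) (P : Module.Basis Idx k (Polynomial.degreeLT k 6)) :
    MvPolynomial Idx KD :=
  ∑ i, C (Polynomial.aeval (zD RatFunc.X) (P i : Polynomial k)) * X i

/-- `j` is equivariant for the involution `ιD` of `D` and the involution of `ℙ(V^∨)` that is
`+1` on `V₊^∨` and `-1` on `V₋^∨`. -/
def IsEquivariant {KC KD : Type u} [Field KC] [Field KD] [Algebra k KD] [Algebra KC KD]
    (zD : RatFunc k ≃ₐ[k] KD) (P : Module.Basis Idx k (Polynomial.degreeLT k 6))
    (ιD : KD ≃ₐ[KC] KD) : Prop :=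
  ∃ c : KD, c ≠ 0 ∧
    (∀ i : Fin 3, ιD (Polynomial.aeval (zD RatFunc.X) (P (Sum.inl i) : Polynomial k)) =
      c * Polynomial.aeval (zD RatFunc.X) (P (Sum.inl i) : Polynomial k)) ∧
    (∀ i : Fin 3, ιD (Polynomial.aeval (zD RatFunc.X) (P (Sum.inr i) : Polynomial k)) =
      -(c * Polynomial.aeval (zD RatFunc.X) (P (Sum.inr i) : Polynomial k)))

attribute [local instance] MvPolynomial.algebraMvPolynomial

/-- The generic point of `i : C → ℙ Sym²(V^∨)`: the norm from `k(D)` to `k(C)` of the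
linear form `J` defining `j`, a quadratic form with coefficients in `k(C)`. If `j` is equivariant,
it has no mixed terms, so it lies in `V' = Sym²(V₊^∨) ⊕ Sym²(V₋^∨)`. -/
noncomputable def normForm (KC : Type u) {KD : Type u} [Field KC] [Field KD] [Algebra KC KD]
    (J : MvPolynomial Idx KD) : MvPolynomial Idx KC :=
  Algebra.norm (MvPolynomial Idx KC) J

/-- The generic point of `h : B → Grass(3, V')`: the image of the dual
`Hom_K(k(C), K) → Sym²(V_K^∨)` of the map `Sym²(V_K^∨)^∨ → k(C)` defined by the form `Q` over
`k(C)`. It consists of the forms obtained by applying a `K`-linear functional `k(C) → K` to the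
coefficients of `Q`. -/
def net (KB : Type u) {KC : Type u} [Field KB] [Field KC] [Algebra KB KC]
    (Q : MvPolynomial Idx KC) : Submodule KB (MvPolynomial Idx KB) where
  carrier := {q | ∃ l : Module.Dual KB KC, ∀ m, q.coeff m = l (Q.coeff m)}
  add_mem' := by
    rintro q r ⟨l, hl⟩ ⟨l', hl'⟩
    exact ⟨l + l', fun m => by simp [hl, hl']⟩
  zero_mem' := ⟨0, by simp⟩
  smul_mem' := by
    rintro c q ⟨l, hl⟩
    exact ⟨c • l, fun m => by simp [hl]⟩

end Net

/-! ### Points and multi-sections of the generic fibre -/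

section Points

variable {K : Type u} [Field K]

/-- The value `s · q(xp, 0) + t · q(0, xm)` at given coordinates of the global section of `𝒪_Z(1)`
defined by an element `q` of `V' = Sym²(V₊^∨) ⊕ Sym²(V₋^∨)`. -/
noncomputable def ZCoord.eval {L : Type u} [Field L] [Algebra K L] (x : ZCoord L)
    (q : MvPolynomial Idx K) : L :=
  x.s * aeval (Sum.elim x.xp 0) q + x.t * aeval (Sum.elim 0 x.xm) q

/-- The set `X(L)` of `L`-points of the subscheme `X ⊆ Z_K` on which all sections in the
subspace `W` of `V'_K` vanish. -/
def XPoints (W : Submodule K (MvPolynomial Idx K)) (L : Type u) [Field L] [Algebra K L] :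
    Set (ZPoint L) :=
  {p | ∃ x : ZCoord L, (Quotient.mk _ x : ZPoint L) = p ∧ ∀ q ∈ W, x.eval q = 0}

/-- An irreducible multi-section of the family with generic fibre `X`, given by its generic point:
this is a closed point of `X`, that is, a finite extension `L` of `K` (the function field of the
multi-section) and an `L`-point of `X` that is defined over no smaller extension. -/
structure IrreducibleMultisection (W : Submodule K (MvPolynomial Idx K)) where
  L : Type u
  [field : Field L]
  [algebra : Algebra K L]
  [finite : FiniteDimensional K L]
  point : ZPoint L
  mem : point ∈ XPoints W L
  eq_top : ∀ F : IntermediateField K L, point ∈ Set.range (ZPoint.map (algebraMap F L)) → F = ⊤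

attribute [instance] IrreducibleMultisection.field IrreducibleMultisection.algebra
  IrreducibleMultisection.finite

/-- The degree of a multi-section over the base. -/
noncomputable def IrreducibleMultisection.degree {W : Submodule K (MvPolynomial Idx K)}
    (T : IrreducibleMultisection W) : ℕ :=
  Module.finrank K T.L

/-- The set of all degrees `[L : K]` of finite extensions `L` of `K` with `X(L) ≠ ∅`. -/
def pointDegrees (W : Submodule K (MvPolynomial Idx K)) : Set ℕ :=
  {n | ∃ (L : Type u) (_ : Field L) (_ : Algebra K L),
    FiniteDimensional K L ∧ (XPoints W L).Nonempty ∧ Module.finrank K L = n}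

end Points

end EnriquesPencil

namespace EnriquesPencil

/-! ### Counting -/

/-! By equivariance, `Q` is a scalar times `A² - κ B²`, where `A` is a linear form on `V₊`, `B` is
one on `V₋`, and `κ = θ²` with `θ` anti-invariant in `k(D)` (`exists_normForm_eq_diagonal`). Over an
algebraic closure `Ω` of `K`, the fibre becomes `s Aᵢ² = t κᵢ Bᵢ²`, where `i` runs over the three
embeddings of `k(C)`. The `Aᵢ` are coordinates on `V₊` and the `Bᵢ` are coordinates on `V₋`.

Let `φ` run over the embeddings of the field `L` of a point. If some `Aᵢ` vanishes at a conjugate of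
the point, then one or two of the three vanish at every conjugate. Galois permutes the `i`
transitively, so counting pairs `(φ, i)` gives `3` (`three_dvd_finrank`). If none vanishes, a square
root `τ` of `t / s` gives `Aᵢ = ± τ θᵢ Bᵢ`, so `φ` determines a set of signs up to complement. The
Galois group contains all independent sign changes and so permutes the `8` sign sets transitively.
Counting then shows that `8` divides twice the number of `φ` (`four_dvd_finrank`).

The wreath product enters only through its order `48`, which is the order of the centralizer of `ι`
in the permutations of the six embeddings of `k(D)`. Degree `3` is attained over `k(C)` by a vertex
of the two coordinate triangles. -/

/-- Double counting for a relation all of whose fibres over `Y` are in bijection. -/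
theorem card_dvd_card_mul_of_relation {X Y : Type*} [Finite X] [Finite Y] (R : X → Y → Prop)
    (hR : ∀ y y', ∃ g : X → X, Function.Injective g ∧ ∀ x, R x y → R (g x) y') {a : ℕ}
    (ha : ∀ x, Nat.card {y // R x y} = a) : Nat.card Y ∣ Nat.card X * a := by
  classical
  have := Fintype.ofFinite X
  have := Fintype.ofFinite Y
  rcases isEmpty_or_nonempty Y with hY | ⟨⟨y₀⟩⟩
  · rcases isEmpty_or_nonempty X with hX | ⟨⟨x⟩⟩
    · simp
    · have h := ha x
      rw [Nat.card_of_isEmpty] at h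
      simp [← h]
  -- Injections in both directions make all fibres over `Y` equally large.
  have hle : ∀ y y', (Finset.univ.bipartiteBelow R y).card ≤
      (Finset.univ.bipartiteBelow R y').card := by
    intro y y'
    obtain ⟨g, hg, h⟩ := hR y y'
    refine Finset.card_le_card_of_injOn g (fun x hx => ?_) hg.injOn
    simp only [Finset.coe_bipartiteBelow, Finset.mem_univ, true_and, Set.mem_ofPred_eq] at hx ⊢
    exact h x hx
  have h := Finset.card_mul_eq_card_mul (s := Finset.univ) (t := Finset.univ) R (m := a)
    (n := (Finset.univ.bipartiteBelow R y₀).card)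
    (fun x _ => by
      rw [← ha x, Nat.card_eq_fintype_card, Fintype.card_subtype]; rfl)
    (fun y _ => le_antisymm (hle _ _) (hle _ _))
  rw [Nat.card_eq_fintype_card, Nat.card_eq_fintype_card]
  exact Dvd.intro _ h.symm

/-- The centralizer of a fixed-point-free involution of a set with six elements has order `48`. -/
theorem card_centralizer_of_involution {E : Type*} [Finite E] (hE : Nat.card E = 6)
    (τ : Equiv.Perm E) (hτ : τ ^ 2 = 1) (hfix : ∀ e, τ e ≠ e) :
    Nat.card (Subgroup.centralizer {τ}) = 48 := by
  classical
  have := Fintype.ofFinite E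
  have hs : τ.support = Finset.univ := by ext e; simp [hfix]
  have hct := Equiv.Perm.cycleType_of_pow_prime_eq_one (p := 2) hτ
  have hsum := τ.sum_cycleType
  rw [hs, Finset.card_univ, ← Nat.card_eq_fintype_card, hE] at hsum
  have hc : τ.cycleType = Multiset.replicate 3 2 := by
    rw [hct] at hsum ⊢
    congr 1
    simp only [Multiset.sum_replicate, smul_eq_mul] at hsum
    omega
  -- With three 2-cycles and no fixed point, the order is `2³ · 3!`.
  rw [Equiv.Perm.nat_card_centralizer, hc, ← Nat.card_eq_fintype_card, hE]
  decide

theorem card_wreathProduct : Nat.card WreathProduct = 48 := by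
  rw [SemidirectProduct.card, Nat.card_eq_fintype_card, Nat.card_eq_fintype_card]
  decide

/-! ### Galois action on embeddings -/

section Galois

variable {K : Type*} [Field K] {Ω : Type*} [Field Ω] [Algebra K Ω]

/-- `g ∘ f⁻¹`, defined on the image of `f`, extends to `Ω` by normality. This is the transitivity
used in both counts, and it needs no separability. -/
theorem exists_algEquiv_comp_eq [IsAlgClosure K Ω] {F : Type*} [Field F] [Algebra K F]
    (f g : F →ₐ[K] Ω) : ∃ σ : Ω ≃ₐ[K] Ω, ∀ x, σ (f x) = g x := by
  have := IsAlgClosure.isAlgebraic (R := K) (K := Ω)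
  have : Normal K Ω := IsAlgClosure.normal K Ω
  let ϕ : f.fieldRange →ₐ[K] Ω := g.comp (AlgEquiv.ofInjectiveField f).symm.toAlgHom
  refine ⟨AlgEquiv.ofBijective (ϕ.liftNormal Ω) (Algebra.IsAlgebraic.algHom_bijective _),
    fun x => ?_⟩
  refine (ϕ.liftNormal_commutes Ω (AlgEquiv.ofInjectiveField f x)).trans ?_
  exact congrArg g ((AlgEquiv.ofInjectiveField f).symm_apply_apply x)

/-- If the Galois closure of a separable extension `D / K` of degree six has degree `48` and `ι` is
an automorphism of order two, then every permutation of the embeddings of `D`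
that commutes with `ι` is induced by an automorphism. -/
theorem exists_algEquiv_comp_eq_perm [IsAlgClosure K Ω] {D : Type*} [Field D] [Algebra K D]
    [FiniteDimensional K D] (hD : Nat.card (D →ₐ[K] Ω) = 6)
    (hN : Nat.card Gal(IntermediateField.normalClosure K D Ω/K) = 48)
    (ι : D ≃ₐ[K] D) (hι : ι ≠ 1) (hι2 : ∀ x, ι (ι x) = x)
    (π : Equiv.Perm (D →ₐ[K] Ω)) (hπ : ∀ e, π (e.comp ι) = (π e).comp ι) :
    ∃ σ : Ω ≃ₐ[K] Ω, ∀ e : D →ₐ[K] Ω, σ.toAlgHom.comp e = π e := by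
  have halg := IsAlgClosure.isAlgebraic (R := K) (K := Ω)
  have : Normal K Ω := IsAlgClosure.normal K Ω
  let N := IntermediateField.normalClosure K D Ω
  have hmem (e : D →ₐ[K] Ω) (x : D) : e x ∈ N := e.fieldRange_le_normalClosure ⟨x, rfl⟩
  let act : Gal(N/K) →* Equiv.Perm (D →ₐ[K] N) :=
    { toFun := fun σ =>
        { toFun := fun e => σ.toAlgHom.comp e
          invFun := fun e => σ.symm.toAlgHom.comp e
          left_inv := fun e => by ext; simp
          right_inv := fun e => by ext; simp }
      map_one' := by ext; simp
      map_mul' := fun σ τ => by ext; simp }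
  let eq : (D →ₐ[K] N) ≃ (D →ₐ[K] Ω) := normalClosure.algHomEquiv K D Ω
  let τ : Equiv.Perm (D →ₐ[K] N) :=
    { toFun := fun e => e.comp ι
      invFun := fun e => e.comp ι
      left_inv := fun e => by ext; simp [hι2]
      right_inv := fun e => by ext; simp [hι2] }
  have hτ2 : τ ^ 2 = 1 := by
    ext e x
    simp [τ, pow_two, hι2]
  have hfix : ∀ e, τ e ≠ e := fun e he => hι <| by
    ext x
    exact e.injective (DFunLike.congr_fun he x)
  have hfin : Finite (D →ₐ[K] N) := Finite.of_equiv _ eq.symm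
  have hcard := card_centralizer_of_involution ((Nat.card_congr eq).trans hD) τ hτ2 hfix
  have hcent : ∀ σ, act σ ∈ Subgroup.centralizer {τ} := by
    intro σ
    rw [Subgroup.mem_centralizer_singleton_iff]
    ext e x
    rfl
  let act' : Gal(N/K) →* Subgroup.centralizer {τ} := act.codRestrict _ hcent
  have hinj : Function.Injective act' := by
    rw [injective_iff_map_eq_one]
    intro σ hσ
    have h1 : ∀ (e : D →ₐ[K] N) x, σ (e x) = e x := fun e x =>
      DFunLike.congr_fun (DFunLike.congr_fun (congrArg Subtype.val hσ) e) x
    -- The images of `D` generate `N`, so an automorphism that fixes each image pointwise is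
    -- trivial.
    have hle : N ≤ (IntermediateField.fixedField (Subgroup.zpowers σ)).map N.val := by
      refine iSup_le fun f => ?_
      rintro _ ⟨x, rfl⟩
      refine ⟨⟨f x, hmem f x⟩, ?_, rfl⟩
      have h2 : σ ⟨f x, hmem f x⟩ = ⟨f x, hmem f x⟩ := h1 (eq.symm f) x
      rintro ⟨ρ, hρ⟩
      have h3 : Subgroup.zpowers σ ≤ MulAction.stabilizer Gal(N/K) (⟨f x, hmem f x⟩ : N) := by
        rw [Subgroup.zpowers_le]
        exact h2
      exact h3 hρ
    ext y
    obtain ⟨y', hy', h⟩ := hle y.2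
    obtain rfl : y' = y := Subtype.ext h
    exact congrArg Subtype.val (hy' ⟨σ, Subgroup.mem_zpowers σ⟩)
  -- An injection between groups of order `48` is onto.
  have hsurj : Function.Surjective act' := by
    have : Finite (Subgroup.centralizer {τ}) := Nat.finite_of_card_ne_zero (by omega)
    exact ((Nat.bijective_iff_injective_and_card _).2 ⟨hinj, by rw [hcard]; exact hN⟩).2
  obtain ⟨σ, hσ⟩ := hsurj ⟨(eq.trans π).trans eq.symm, by
    rw [Subgroup.mem_centralizer_singleton_iff]
    ext1 e
    apply eq.injective
    have h2 : ∀ e', eq (τ e') = (eq e').comp ι := fun _ => rfl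
    simp only [Equiv.Perm.coe_mul, Function.comp_apply, Equiv.trans_apply, h2,
      Equiv.apply_symm_apply, hπ]⟩
  refine ⟨σ.liftNormal Ω, fun e => ?_⟩
  ext x
  have h1 : act σ (eq.symm e) = eq.symm (π e) := by
    rw [show act σ = (eq.trans π).trans eq.symm from congrArg Subtype.val hσ]
    simp
  have h2 : eq (act σ (eq.symm e)) x = π e x := by rw [h1, Equiv.apply_symm_apply]
  exact (σ.liftNormal_commutes Ω ⟨e x, hmem e x⟩).trans h2

end Galois

/-! ### Divisibility of degrees by `3` and by `4` -/

section Divisibility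

variable {K C D Ω : Type*} [Field K] [Field C] [Field D] [Field Ω] [Algebra K C] [Algebra C D]
  [Algebra K D] [IsScalarTower K C D] [Algebra K Ω]

/-- Restriction of embeddings from `D` to the subextension `C`. -/
def restrictEmb (e : D →ₐ[K] Ω) : C →ₐ[K] Ω := e.comp (IsScalarTower.toAlgHom K C D)

theorem restrictEmb_apply (e : D →ₐ[K] Ω) (x : C) :
    restrictEmb e x = e (algebraMap C D x) := rfl

theorem restrictEmb_surjective [FiniteDimensional K D] [IsAlgClosed Ω] :
    Function.Surjective (restrictEmb : (D →ₐ[K] Ω) → (C →ₐ[K] Ω)) := by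
  intro i
  have : FiniteDimensional C D := FiniteDimensional.right K C D
  let := i.toRingHom.toAlgebra
  have : IsScalarTower K C Ω := .of_algebraMap_eq fun x => (i.commutes x).symm
  let e : D →ₐ[C] Ω := IsAlgClosed.lift
  exact ⟨e.restrictScalars K, AlgHom.ext fun x => e.commutes x⟩

theorem restrictEmb_comp (e : D →ₐ[K] Ω) (ι : D ≃ₐ[C] D) :
    (restrictEmb (e.comp (ι.restrictScalars K).toAlgHom) : C →ₐ[K] Ω) = restrictEmb e := by
  ext x
  simp [restrictEmb]

/-- Any set of fibres of the restriction of embeddings from `D` to `C` can be flipped by an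
automorphism. -/
theorem exists_algEquiv_flip [IsAlgClosure K Ω] [FiniteDimensional K D]
    (hD : Nat.card (D →ₐ[K] Ω) = 6)
    (hN : Nat.card Gal(IntermediateField.normalClosure K D Ω/K) = 48)
    (ι : D ≃ₐ[C] D) (hι : ι ≠ 1) (hι2 : ∀ x, ι (ι x) = x) (S : Set (C →ₐ[K] Ω)) :
    ∃ σ : Ω ≃ₐ[K] Ω, ∀ e : D →ₐ[K] Ω,
      (restrictEmb e ∈ S → ∀ x, σ (e x) = e (ι x)) ∧ (restrictEmb e ∉ S → ∀ x, σ (e x) = e x) := by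
  classical
  -- Composing with `ι` preserves the restriction to `C`. Hence `f` preserves the fibres, is
  -- involutive and commutes with `ι`.
  let f : (D →ₐ[K] Ω) → (D →ₐ[K] Ω) := fun e =>
    if restrictEmb e ∈ S then e.comp (ι.restrictScalars K).toAlgHom else e
  have hf : Function.Involutive f := by
    intro e
    by_cases h : restrictEmb e ∈ S
    · simp only [f, h, if_true, restrictEmb_comp]
      ext x
      simp [hι2]
    · simp [f, h]
  obtain ⟨σ, hσ⟩ := exists_algEquiv_comp_eq_perm hD hN (ι.restrictScalars K)
    (fun h => hι (AlgEquiv.ext fun x => DFunLike.congr_fun h x)) hι2 hf.toPerm (by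
      intro e
      simp only [Function.Involutive.coe_toPerm, f]
      change (if restrictEmb (e.comp (ι.restrictScalars K).toAlgHom) ∈ S then _ else _) = _
      rw [restrictEmb_comp]
      split_ifs <;> rfl)
  refine ⟨σ, fun e => ⟨fun h x => ?_, fun h x => ?_⟩⟩
  · have := DFunLike.congr_fun (hσ e) x
    simpa [f, h] using this
  · have := DFunLike.congr_fun (hσ e) x
    simpa [f, h] using this

variable {L : Type*} [Field L] [Algebra K L]

/-- The value at the conjugate by `φ` of a vector `x` of the conjugate by `i` of the linear form
with coefficients `α`. -/
def formValue (α : Fin 3 → C) (x : Fin 3 → L) (φ : L →ₐ[K] Ω) (i : C →ₐ[K] Ω) : Ω :=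
  ∑ j, i (α j) * φ (x j)

theorem map_formValue (σ : Ω ≃ₐ[K] Ω) (α : Fin 3 → C) (x : Fin 3 → L) (φ : L →ₐ[K] Ω)
    (i : C →ₐ[K] Ω) : σ (formValue α x φ i) =
      formValue α x (σ.toAlgHom.comp φ) (σ.toAlgHom.comp i) := by
  simp [formValue]

theorem comp_algEquiv_injective {F : Type*} [Field F] [Algebra K F] (σ : Ω ≃ₐ[K] Ω) :
    Function.Injective fun φ : F →ₐ[K] Ω => σ.toAlgHom.comp φ := fun _ _ h =>
  AlgHom.ext fun x => σ.injective (DFunLike.congr_fun h x)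

/-- If some but not all of the conjugates of a linear form over a cubic extension vanish at a point,
the degree of the point is divisible by `3`. -/
theorem three_dvd_finrank [IsAlgClosure K Ω] [FiniteDimensional K C] [FiniteDimensional K L]
    (hC : Nat.card (C →ₐ[K] Ω) = 3) (α : Fin 3 → C) (x : Fin 3 → L)
    (hne : ∀ φ : L →ₐ[K] Ω, ∃ i : C →ₐ[K] Ω, formValue α x φ i ≠ 0)
    (hex : ∃ (φ : L →ₐ[K] Ω) (i : C →ₐ[K] Ω), formValue α x φ i = 0) :
    3 ∣ Module.finrank K L := by
  have hac := IsAlgClosure.isAlgClosed K (K := Ω)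
  obtain ⟨φ₀, i₀, h₀⟩ := hex
  let R : (L →ₐ[K] Ω) → (C →ₐ[K] Ω) → Prop := fun φ i => formValue α x φ i = 0
  have hR : ∀ (σ : Ω ≃ₐ[K] Ω) φ i, R (σ.toAlgHom.comp φ) (σ.toAlgHom.comp i) ↔ R φ i := by
    intro σ φ i
    simp only [R, ← map_formValue, map_eq_zero_iff _ σ.injective]
  have h1 := card_dvd_card_mul_of_relation R (a := Nat.card {i // R φ₀ i}) (by
      intro i i'
      obtain ⟨σ, hσ⟩ := exists_algEquiv_comp_eq i i'
      refine ⟨_, comp_algEquiv_injective σ, fun φ h => ?_⟩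
      have : σ.toAlgHom.comp i = i' := AlgHom.ext hσ
      rw [← this]
      exact (hR σ φ i).2 h) (by
      intro φ
      obtain ⟨σ, hσ⟩ := exists_algEquiv_comp_eq φ φ₀
      have h : σ.toAlgHom.comp φ = φ₀ := AlgHom.ext hσ
      refine Nat.card_congr ⟨fun i => ⟨σ.toAlgHom.comp i.1, ?_⟩,
        fun i => ⟨σ.symm.toAlgHom.comp i.1, ?_⟩, fun i => ?_, fun i => ?_⟩
      · rw [← h]
        exact (hR σ _ _).2 i.2
      · rw [← hR σ, h]
        convert i.2
        ext; simp
      · ext; simp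
      · ext; simp)
  -- The number of vanishing conjugates is `1` or `2`, hence prime to `3`.
  have hpos : 0 < Nat.card {i // R φ₀ i} := Nat.card_pos_iff.2 ⟨⟨i₀, h₀⟩, inferInstance⟩
  have hlt : Nat.card {i // R φ₀ i} < 3 := by
    rw [← hC]
    obtain ⟨i, hi⟩ := hne φ₀
    have := Fintype.ofFinite (C →ₐ[K] Ω)
    classical
    rw [Nat.card_eq_fintype_card, Nat.card_eq_fintype_card]
    exact Fintype.card_subtype_lt hi
  rw [hC, ← Field.finSepDegree_eq_of_isAlgClosed K L Ω] at h1
  refine ((Nat.prime_three.dvd_mul.1 h1).resolve_right fun h => ?_).trans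
    (Field.finSepDegree_dvd_finrank K L)
  exact absurd (Nat.le_of_dvd hpos h) (by omega)

/-- If no conjugate of the linear form vanishes at the point, the degree of the point is
divisible by `4`. -/
theorem four_dvd_finrank [IsAlgClosure K Ω] [FiniteDimensional K D] [FiniteDimensional K C]
    [FiniteDimensional K L] (h2 : (2 : Ω) ≠ 0)
    (hC : Nat.card (C →ₐ[K] Ω) = 3) (hD : Nat.card (D →ₐ[K] Ω) = 6)
    (hN : Nat.card Gal(IntermediateField.normalClosure K D Ω/K) = 48)
    (ι : D ≃ₐ[C] D) (hι : ι ≠ 1) (hι2 : ∀ x, ι (ι x) = x)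
    (θ : D) (hθ : ι θ = -θ) (κ : C) (hκ : θ ^ 2 = algebraMap C D κ)
    (α β : Fin 3 → C) (xp xm : Fin 3 → L) (s t : L) (hs : s ≠ 0)
    (hX : ∀ (φ : L →ₐ[K] Ω) (i : C →ₐ[K] Ω),
      φ s * formValue α xp φ i ^ 2 = φ t * (i κ * formValue β xm φ i ^ 2))
    (hne : ∀ (φ : L →ₐ[K] Ω) (i : C →ₐ[K] Ω), formValue α xp φ i ≠ 0) :
    4 ∣ Module.finrank K L := by
  have hac := IsAlgClosure.isAlgClosed K (K := Ω)
  -- A choice of extension `e i` for each `i` amounts to a choice of square root `e i θ` of `i κ`.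
  obtain ⟨e, he⟩ := (restrictEmb_surjective (K := K) (C := C) (D := D) (Ω := Ω)).hasRightInverse
  let w (φ : L →ₐ[K] Ω) (τ : Ω) (i : C →ₐ[K] Ω) : Ω := τ * e i θ * formValue β xm φ i
  have hsq : ∀ φ τ i, φ s * τ ^ 2 = φ t → formValue α xp φ i ^ 2 = w φ τ i ^ 2 := by
    intro φ τ i h
    have h1 : e i θ ^ 2 = i κ := by
      rw [← map_pow, hκ, ← restrictEmb_apply, he]
    have hs' : φ s ≠ 0 := by simpa using hs
    apply mul_left_cancel₀ hs'
    rw [hX, ← h, ← h1]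
    ring
  have hneg : ∀ φ τ i, φ s * τ ^ 2 = φ t →
      (formValue α xp φ i = -w φ τ i ↔ ¬ formValue α xp φ i = w φ τ i) := by
    intro φ τ i h
    constructor
    · intro h1 h3
      apply hne φ i
      have : 2 * formValue α xp φ i = 0 := by linear_combination h1 + h3
      exact (mul_eq_zero.1 this).resolve_left h2
    · intro h1
      exact (sq_eq_sq_iff_eq_or_eq_neg.1 (hsq φ τ i h)).resolve_left h1
  -- `F` is the set of indices with sign `+`, for one of the two square roots `τ` of `φ t / φ s`.
  let R : (L →ₐ[K] Ω) → Set (C →ₐ[K] Ω) → Prop := fun φ F =>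
    ∃ τ, φ s * τ ^ 2 = φ t ∧ F = {i | formValue α xp φ i = w φ τ i}
  have h8 := card_dvd_card_mul_of_relation R (a := 2) (by
    intro F F'
    -- This `σ` fixes every `i` and negates `e i θ` exactly where `F` and `F'` differ, so it carries
    -- sign set `F` to `F'`.
    obtain ⟨σ, hσ⟩ := exists_algEquiv_flip hD hN ι hι hι2 (symmDiff F F')
    refine ⟨_, comp_algEquiv_injective σ, ?_⟩
    rintro φ ⟨τ, hτ, hF⟩
    have hσi (i : C →ₐ[K] Ω) : σ.toAlgHom.comp i = i := by
      ext x
      have h := hσ (e i)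
      have h1 : i x = e i (algebraMap C D x) := by rw [← restrictEmb_apply, he]
      change σ (i x) = i x
      by_cases hi : restrictEmb (e i) ∈ symmDiff F F'
      · rw [h1, h.1 hi, ι.commutes]
      · rw [h1, h.2 hi]
    refine ⟨σ τ, by simpa using congrArg σ hτ, ?_⟩
    ext i
    have hval : formValue α xp (σ.toAlgHom.comp φ) i = σ (formValue α xp φ i) := by
      rw [map_formValue, hσi]
    have hval' : formValue β xm (σ.toAlgHom.comp φ) i = σ (formValue β xm φ i) := by
      rw [map_formValue, hσi]
    have hFi : i ∈ F ↔ formValue α xp φ i = w φ τ i := by rw [hF]; rfl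
    change _ ↔ formValue α xp (σ.toAlgHom.comp φ) i =
      σ τ * e i θ * formValue β xm (σ.toAlgHom.comp φ) i
    rw [hval, hval']
    have h := hσ (e i)
    rw [he] at h
    by_cases hi : i ∈ symmDiff F F'
    · have h1 : e i θ = σ (- e i θ) := by rw [map_neg, h.1 hi, hθ, map_neg, neg_neg]
      rw [h1, ← map_mul, ← map_mul, σ.injective.eq_iff,
        show τ * -e i θ * formValue β xm φ i = -w φ τ i by simp [w], hneg φ τ i hτ, ← hFi]
      rw [Set.mem_symmDiff] at hi
      tauto
    · have h1 : e i θ = σ (e i θ) := by rw [h.2 hi]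
      rw [h1, ← map_mul, ← map_mul, σ.injective.eq_iff]
      change _ ↔ formValue α xp φ i = w φ τ i
      rw [← hFi]
      rw [Set.mem_symmDiff] at hi
      tauto) (by
    intro φ
    have hs' : φ s ≠ 0 := by simpa using hs
    obtain ⟨τ, hτ⟩ := IsAlgClosed.exists_pow_nat_eq (φ t / φ s) two_pos
    replace hτ : φ s * τ ^ 2 = φ t := by rw [hτ]; field_simp
    let F := {i | formValue α xp φ i = w φ τ i}
    have hflip (i) : formValue α xp φ i = w φ (-τ) i ↔ ¬ formValue α xp φ i = w φ τ i := by
      rw [← hneg φ τ i hτ]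
      simp [w]
    -- Replacing `τ` by `-τ` reverses every sign.
    have hR : {F' | R φ F'} = {F, Fᶜ} := by
      ext F'
      constructor
      · rintro ⟨τ', hτ', hF'⟩
        have : τ' ^ 2 = τ ^ 2 := mul_left_cancel₀ hs' (hτ'.trans hτ.symm)
        rcases sq_eq_sq_iff_eq_or_eq_neg.1 this with rfl | rfl
        · exact Or.inl hF'
        · right
          rw [Set.mem_singleton_iff, hF']
          exact Set.ext hflip
      · rintro (rfl | rfl)
        · exact ⟨τ, hτ, rfl⟩
        · refine ⟨-τ, by rw [neg_sq, hτ], ?_⟩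
          exact Set.ext fun i => (hflip i).symm
    have : Nonempty (C →ₐ[K] Ω) := (Nat.card_pos_iff.1 (by omega)).1
    have h := Set.ncard_pair (ne_compl_self (a := F))
    rw [← hR] at h
    exact h)
  have h4 : Nat.card (Set (C →ₐ[K] Ω)) = 8 := by
    have := Fintype.ofFinite (C →ₐ[K] Ω)
    rw [Nat.card_eq_fintype_card, Fintype.card_set, ← Nat.card_eq_fintype_card, hC]
    rfl
  rw [h4, ← Field.finSepDegree_eq_of_isAlgClosed K L Ω] at h8
  refine dvd_trans ?_ (Field.finSepDegree_dvd_finrank K L)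
  omega

end Divisibility

open MvPolynomial

/-! ### Conjugates of a basis -/

section TraceDual

variable {K C Ω : Type*} [Field K] [Field C] [Field Ω] [Algebra K C] [Algebra K Ω]
  [FiniteDimensional K C] [Algebra.IsSeparable K C] [IsAlgClosed Ω]

theorem sum_embeddings_mul_traceDual {n : Type*} [Fintype n] [DecidableEq n]
    (b : Module.Basis n K C) (j k : n) :
    ∑ i : C →ₐ[K] Ω, i (b j) * i (b.traceDual k) = if j = k then 1 else 0 := by
  simp_rw [← map_mul]
  rw [← trace_eq_sum_embeddings, b.trace_mul_traceDual]
  split_ifs <;> simp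

/-- The matrix of conjugates of `b` is inverted by that of the trace dual basis, so the conjugate
linear forms have no common nontrivial zero. -/
theorem eq_zero_of_forall_sum_embeddings {n : Type*} [Fintype n]
    (b : Module.Basis n K C) (y : n → Ω) (h : ∀ i : C →ₐ[K] Ω, ∑ j, i (b j) * y j = 0) : y = 0 := by
  classical
  ext k
  calc y k = ∑ j, (∑ i : C →ₐ[K] Ω, i (b j) * i (b.traceDual k)) * y j := by
        simp [sum_embeddings_mul_traceDual]
    _ = ∑ i : C →ₐ[K] Ω, i (b.traceDual k) * ∑ j, i (b j) * y j := by
        simp_rw [Finset.sum_mul, Finset.mul_sum]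
        rw [Finset.sum_comm]
        exact Finset.sum_congr rfl fun i _ => Finset.sum_congr rfl fun j _ => by ring
    _ = 0 := by simp [h]

/-- The same two inverse matrices multiplied in the other order. The conjugate by `i'` of the dual
basis is the point where only the form of index `i'` is nonzero. -/
theorem sum_basis_mul_traceDual {n : Type*} [Fintype n] [DecidableEq n]
    (b : Module.Basis n K C) (i i' : C →ₐ[K] Ω) [Decidable (i = i')] :
    ∑ j, i (b j) * i' (b.traceDual j) = if i = i' then 1 else 0 := by
  classical
  let M : Matrix n (C →ₐ[K] Ω) Ω := fun j i => i (b j)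
  let N : Matrix (C →ₐ[K] Ω) n Ω := fun i j => i (b.traceDual j)
  have h : M * N = 1 := by
    ext j k
    rw [Matrix.mul_apply, Matrix.one_apply]
    exact sum_embeddings_mul_traceDual b j k
  have hcard : Fintype.card n = Fintype.card (C →ₐ[K] Ω) := by
    rw [AlgHom.card, Module.finrank_eq_card_basis b]
  have h' := congrFun (congrFun ((Matrix.mul_eq_one_comm_of_card_eq _ _ _ hcard).1 h) i') i
  rw [Matrix.mul_apply, Matrix.one_apply] at h'
  simp_rw [mul_comm (i _), eq_comm (a := i)]
  convert h'

end TraceDual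

/-! ### The norm form -/

section Norm

attribute [local instance] MvPolynomial.algebraMvPolynomial

variable {E D : Type*} [Field E] [Field D] [Algebra E D]

/-- The norm of `A + θ B` for a quadratic extension generated by `θ` with `θ² = κ`. -/
theorem norm_add_mul_sqrt {σ : Type*} (b : Module.Basis (Fin 2) E D) (h0 : b 0 = 1) (κ : E)
    (hκ : b 1 ^ 2 = algebraMap E D κ) (A B : MvPolynomial σ E) :
    Algebra.norm (MvPolynomial σ E) (map (algebraMap E D) A + C (b 1) * map (algebraMap E D) B) =
      A ^ 2 - C κ * B ^ 2 := by
  -- The polynomial ring over `D` is the base change of `D`, so `b` remains a basis and the norm is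
  -- a `2 × 2` determinant.
  let ibc := (Algebra.IsPushout.out : IsBaseChange (MvPolynomial σ E)
    (IsScalarTower.toAlgHom E D (MvPolynomial σ D)).toLinearMap)
  let b' := ibc.basis b
  have hb0 : b' 0 = 1 := by
    rw [ibc.basis_apply, h0]; simp
  have hb1 : b' 1 = C (b 1) := by
    rw [ibc.basis_apply]; rfl
  have hs : ∀ (p : MvPolynomial σ E) (q : MvPolynomial σ D), p • q = map (algebraMap E D) p * q :=
    fun p q => by rw [Algebra.smul_def]; rfl
  set J := map (algebraMap E D) A + C (b 1) * map (algebraMap E D) B with hJ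
  have e0 : J * b' 0 = A • b' 0 + B • b' 1 := by
    rw [hb0, hb1, hs, hs]; ring
  have e1 : J * b' 1 = (C κ * B) • b' 0 + A • b' 1 := by
    rw [hb0, hb1, hs, hs, map_mul, map_C, ← hκ, hJ, map_pow]
    ring
  rw [Algebra.norm_eq_matrix_det b', Matrix.det_fin_two]
  simp only [Algebra.leftMulMatrix_eq_repr_mul, e0, e1]
  simp
  ring

end Norm

/-! ### Points of the generic fibre over an algebraically closed field -/

section Conjugates

variable {K E Ω : Type u} [Field K] [Field E] [Field Ω] [Algebra K E] [Algebra K Ω]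
  {L : Type u} [Field L] [Algebra K L]

/-- The value at the conjugate by `φ` of a point of `Z` of a quadratic form over `Ω`. -/
noncomputable def conjEval (x : ZCoord L) (φ : L →ₐ[K] Ω) : MvPolynomial Idx Ω →ₗ[Ω] Ω :=
  φ x.s • (aeval (φ ∘ Sum.elim x.xp 0)).toLinearMap +
    φ x.t • (aeval (φ ∘ Sum.elim 0 x.xm)).toLinearMap

theorem conjEval_apply (x : ZCoord L) (φ : L →ₐ[K] Ω) (f : MvPolynomial Idx Ω) :
    conjEval x φ f = φ x.s * aeval (φ ∘ Sum.elim x.xp 0) f +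
      φ x.t * aeval (φ ∘ Sum.elim 0 x.xm) f := rfl

theorem map_zCoordEval (x : ZCoord L) (φ : L →ₐ[K] Ω) (q : MvPolynomial Idx K) :
    φ (x.eval q) = conjEval x φ (map (algebraMap K Ω) q) := by
  have h (y : Idx → L) : φ (aeval y q) = aeval (φ ∘ y) (map (algebraMap K Ω) q) := by
    rw [aeval_map_algebraMap]
    exact comp_aeval_apply y φ q
  rw [ZCoord.eval, map_add, map_mul, map_mul, h, h, conjEval_apply]

/-- A point lies on all forms of the net of `Q` if and only if all conjugates of `Q` vanish there. -/
theorem forall_mem_net_eval_eq_zero_iff [FiniteDimensional K E] [Algebra.IsSeparable K E]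
    [IsAlgClosed Ω] (Q : MvPolynomial Idx E) (x : ZCoord L) (φ : L →ₐ[K] Ω) :
    (∀ q ∈ net K Q, x.eval q = 0) ↔
      ∀ i : E →ₐ[K] Ω, conjEval x φ (map (i : E →+* Ω) Q) = 0 := by
  constructor
  · intro h i
    -- The coordinates of `Q` in a `K`-basis lie in the net, and each conjugate of `Q` is a
    -- combination of them.
    let b := Module.finBasis K E
    let q (j) : MvPolynomial Idx K := ∑ m ∈ Q.support, monomial m (b.coord j (Q.coeff m))
    have hq (j m) : (q j).coeff m = b.coord j (Q.coeff m) := by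
      simp only [q, coeff_sum, coeff_monomial]
      rw [Finset.sum_ite_eq']
      split_ifs with hm
      · rfl
      · rw [notMem_support_iff.1 hm, map_zero]
    have hQ : map (i : E →+* Ω) Q = ∑ j, i (b j) • map (algebraMap K Ω) (q j) := by
      ext m
      rw [coeff_map, coeff_sum]
      simp only [coeff_smul, coeff_map, hq, smul_eq_mul]
      conv_lhs => rw [← b.sum_repr (Q.coeff m)]
      simp [Algebra.smul_def, mul_comm]
    rw [hQ, map_sum]
    refine Finset.sum_eq_zero fun j _ => ?_
    rw [map_smul, ← map_zCoordEval, h (q j) ⟨b.coord j, hq j⟩, map_zero, smul_zero]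
  · rintro h q ⟨l, hl⟩
    refine (map_eq_zero φ).1 ?_
    -- By separability every functional is a trace against some `μ`, so a form of the net is a
    -- combination of conjugates of `Q`.
    obtain ⟨μ, rfl⟩ := ((Algebra.traceForm K E).toDual (traceForm_nondegenerate K E)).surjective l
    have hq : map (algebraMap K Ω) q = ∑ i : E →ₐ[K] Ω, i μ • map (i : E →+* Ω) Q := by
      ext m
      rw [coeff_map, hl, LinearMap.BilinForm.toDual_def, Algebra.traceForm_apply,
        trace_eq_sum_embeddings (E := Ω), coeff_sum]
      exact Finset.sum_congr rfl fun i _ => by rw [coeff_smul, coeff_map, map_mul]; rfl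
    rw [map_zCoordEval, hq, map_sum]
    exact Finset.sum_eq_zero fun i _ => by rw [map_smul, h i, smul_zero]

theorem conjEval_diagonal (α β : Fin 3 → E) (n κ : E) (x : ZCoord L) (φ : L →ₐ[K] Ω)
    (i : E →ₐ[K] Ω) :
    conjEval x φ (map (i : E →+* Ω) (C n * ((∑ j, C (α j) * X (Sum.inl j)) ^ 2 -
      C κ * (∑ j, C (β j) * X (Sum.inr j)) ^ 2))) =
      i n * (φ x.s * formValue α x.xp φ i ^ 2 - φ x.t * (i κ * formValue β x.xm φ i ^ 2)) := by
  simp [conjEval_apply, formValue]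
  ring

end Conjugates

/-! ### Linear independence of the coordinates of the rational normal curve -/

section Coordinates

variable {k K D : Type*} [Field k] [Field K] [Field D] [Algebra k K] [Algebra k D] [Algebra K D]
  [IsScalarTower k K D]

theorem adjoin_ratFunc_generator_eq_top (zD : RatFunc k ≃ₐ[k] D) :
    IntermediateField.adjoin K {zD RatFunc.X} = ⊤ := by
  rw [eq_top_iff]
  intro y _
  have hpoly (p : Polynomial k) : zD (algebraMap (Polynomial k) (RatFunc k) p) ∈
      IntermediateField.adjoin K {zD RatFunc.X} := by
    have : zD (algebraMap (Polynomial k) (RatFunc k) p) = Polynomial.aeval (zD RatFunc.X) p := by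
      rw [Polynomial.aeval_algHom_apply]
      simp
    rw [this, Polynomial.aeval_eq_sum_range]
    refine sum_mem fun n _ => ?_
    rw [← IsScalarTower.algebraMap_smul K]
    exact IntermediateField.smul_mem _ (pow_mem (IntermediateField.mem_adjoin_simple_self K _) n)
  obtain ⟨r, rfl⟩ := zD.surjective y
  rw [← RatFunc.num_div_denom r, map_div₀]
  exact div_mem (hpoly _) (hpoly _)

/-- The coordinate `z` generates `D` over `K`, so the powers `z ^ m` with `m < n` span. The values
of `P` span these powers, and `n` spanning elements are independent. For `n = 6` this is where
degree `5` matches `[k(D) : k(B)]`. -/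
theorem linearIndependent_aeval_generator (zD : RatFunc k ≃ₐ[k] D) {n : ℕ} {ι : Type*} [Fintype ι]
    (hn : Module.finrank K D = n) (hn0 : n ≠ 0) (hι : Fintype.card ι = n)
    (P : Module.Basis ι k (Polynomial.degreeLT k n)) :
    LinearIndependent K fun i => Polynomial.aeval (zD RatFunc.X) (P i : Polynomial k) := by
  have : FiniteDimensional K D := FiniteDimensional.of_finrank_pos (by omega)
  set z := zD RatFunc.X
  have hz : IsIntegral K z := IsIntegral.of_finite K z
  have htop := adjoin_ratFunc_generator_eq_top (K := K) zD
  have hdeg : (minpoly K z).natDegree = n := by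
    rw [← IntermediateField.adjoin.finrank hz, htop, IntermediateField.finrank_top', hn]
  refine linearIndependent_of_top_le_span_of_card_eq_finrank ?_ (by rw [hι, hn])
  have hmem (m : ℕ) (hm : m < n) : z ^ m ∈ Submodule.span K
      (Set.range fun i => Polynomial.aeval z (P i : Polynomial k)) := by
    have hX : (Polynomial.X ^ m : Polynomial k) ∈ Polynomial.degreeLT k n := by
      rw [Polynomial.mem_degreeLT, Polynomial.degree_X_pow]
      exact_mod_cast hm
    have h := congrArg (fun p : Polynomial.degreeLT k n => Polynomial.aeval z (p : Polynomial k))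
      (P.sum_repr ⟨_, hX⟩)
    simp only [map_pow, Polynomial.aeval_X, AddSubmonoidClass.coe_finsetSum, Submodule.coe_smul,
      map_sum, map_smul] at h
    rw [← h]
    refine sum_mem fun i _ => ?_
    rw [← IsScalarTower.algebraMap_smul K]
    exact Submodule.smul_mem _ _ (Submodule.subset_span ⟨i, rfl⟩)
  intro y _
  have hy : y ∈ IntermediateField.adjoin K {z} := by rw [htop]; trivial
  let pb := IntermediateField.adjoin.powerBasis hz
  have h := congrArg (algebraMap (IntermediateField.adjoin K {z}) D) (pb.basis.sum_repr ⟨y, hy⟩)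
  rw [map_sum] at h
  change _ = y at h
  rw [← h]
  refine sum_mem fun i _ => ?_
  rw [Algebra.smul_def, map_mul, ← IsScalarTower.algebraMap_apply, ← Algebra.smul_def,
    pb.coe_basis, map_pow]
  refine Submodule.smul_mem _ _ (hmem _ ?_)
  exact i.2.trans_eq ((IntermediateField.adjoin.powerBasis_dim hz).trans hdeg)

end Coordinates

/-! ### The quadratic extension -/

section Quadratic

variable {E D : Type*} [Field E] [Field D] [Algebra E D]

theorem involutive_of_finrank_eq_two (h : Module.finrank E D = 2) (ι : D ≃ₐ[E] D) (hι : ι ≠ 1)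
    (x : D) : ι (ι x) = x := by
  have : FiniteDimensional E D := FiniteDimensional.of_finrank_pos (by omega)
  have hle := AlgEquiv.card_le (F := E) (K := D)
  rw [h, ← Nat.card_eq_fintype_card] at hle
  have hlt : 1 < Nat.card (D ≃ₐ[E] D) := by
    rw [Nat.card_eq_fintype_card]
    exact Fintype.one_lt_card_iff.2 ⟨ι, 1, hι⟩
  have h2 : Nat.card (D ≃ₐ[E] D) = 2 := by omega
  have := pow_card_eq_one' (x := ι)
  rw [h2] at this
  simpa [pow_two] using DFunLike.congr_fun this x

/-- The basis `1, θ` of a quadratic extension given by an anti-invariant element. -/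
theorem exists_basis_one_sqrt (h2 : (2 : D) ≠ 0) (h : Module.finrank E D = 2) (ι : D ≃ₐ[E] D)
    {θ : D} (hθ0 : θ ≠ 0) (hθ : ι θ = -θ) :
    ∃ b : Module.Basis (Fin 2) E D, b 0 = 1 ∧ b 1 = θ := by
  have hli : LinearIndependent E ![1, θ] := by
    rw [LinearIndependent.pair_iff' one_ne_zero]
    intro a ha
    have h1 : ι θ = θ := by rw [← ha, map_smul, map_one]
    rw [hθ] at h1
    have : 2 * θ = 0 := by linear_combination -h1
    exact (mul_ne_zero h2 hθ0) this
  exact ⟨basisOfLinearIndependentOfCardEqFinrank hli (by simp [h]), by simp, by simp⟩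

/-- In the basis `1, θ`, invariance kills the coefficient of `θ`. -/
theorem mem_range_algebraMap_of_fixed (h2 : (2 : D) ≠ 0) (h : Module.finrank E D = 2)
    (ι : D ≃ₐ[E] D) {θ : D} (hθ0 : θ ≠ 0) (hθ : ι θ = -θ) {x : D} (hx : ι x = x) :
    ∃ a : E, algebraMap E D a = x := by
  obtain ⟨b, hb0, hb1⟩ := exists_basis_one_sqrt h2 h ι hθ0 hθ
  have hs := b.sum_repr x
  rw [Fin.sum_univ_two, hb0, hb1] at hs
  have h1 := congrArg ι hs
  rw [map_add, map_smul, map_smul, map_one, hθ, hx, smul_neg] at h1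
  have h3 : 2 * (b.repr x 1 • θ) = 0 := by linear_combination hs - h1
  have h4 := (mul_eq_zero.1 h3).resolve_left h2
  rw [h4, add_zero, Algebra.smul_def, mul_one] at hs
  exact ⟨_, hs⟩

end Quadratic

/-! ### Diagonal form of the norm -/

section Diagonal

attribute [local instance] MvPolynomial.algebraMvPolynomial

variable {k KB KC KD : Type u} [Field k] [Field KB] [Field KC] [Field KD]
  [Algebra k KB] [Algebra k KD] [Algebra KB KC] [Algebra KC KD] [Algebra KB KD]
  [IsScalarTower k KB KD] [IsScalarTower KB KC KD]

/-- Independent elements of `KD` that are `KC`-multiples of `A` give a basis of `KC`. -/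
theorem exists_basis_of_mul_eq (hf : Module.finrank KB KC = 3) {A : KD} {p : Fin 3 → KD}
    (hp : LinearIndependent KB p) (h : ∀ j, ∃ a : KC, algebraMap KC KD a * A = p j) :
    ∃ α : Module.Basis (Fin 3) KB KC, ∀ j, algebraMap KC KD (α j) * A = p j := by
  choose a ha using h
  have hli : LinearIndependent KB a := by
    refine LinearIndependent.of_comp
      ((LinearMap.mulRight KB A).comp (IsScalarTower.toAlgHom KB KC KD).toLinearMap) ?_
    have h : p = fun j => algebraMap KC KD (a j) * A := funext fun j => (ha j).symm
    rw [h] at hp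
    exact hp
  exact ⟨basisOfLinearIndependentOfCardEqFinrank hli (by simp [hf]), fun j => by simp [ha]⟩

theorem sum_C_mul_X_eq {E D : Type*} [Field E] [Field D] [Algebra E D] (p : Idx → D) {A θ : D}
    {α β : Fin 3 → E} (hα : ∀ j, algebraMap E D (α j) * A = p (Sum.inl j))
    (hβ : ∀ j, algebraMap E D (β j) * (A * θ) = p (Sum.inr j)) :
    ∑ i, C (p i) * X i = C A * (map (algebraMap E D) (∑ j, C (α j) * X (Sum.inl j)) +
      C θ * map (algebraMap E D) (∑ j, C (β j) * X (Sum.inr j))) := by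
  rw [Fintype.sum_sum_type, mul_add]
  simp only [← hα, ← hβ, map_sum, map_mul, map_C, map_X, Finset.mul_sum]
  exact congrArg₂ (· + ·) (Finset.sum_congr rfl fun j _ => by ring)
    (Finset.sum_congr rfl fun j _ => by ring)

/-- The norm form is, up to a scalar, the difference of a square on `V₊` and a multiple of
a square on `V₋`. -/
theorem exists_normForm_eq_diagonal (h2 : (2 : KD) ≠ 0) (zD : RatFunc k ≃ₐ[k] KD)
    (hf : Module.finrank KB KC = 3) (hg : Module.finrank KC KD = 2)
    (ιD : KD ≃ₐ[KC] KD) (P : Module.Basis Idx k (Polynomial.degreeLT k 6))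
    (hP : IsEquivariant zD P ιD) :
    ∃ (θ : KD) (κ n : KC) (α β : Module.Basis (Fin 3) KB KC), ιD θ = -θ ∧
      θ ^ 2 = algebraMap KC KD κ ∧ κ ≠ 0 ∧ n ≠ 0 ∧
      normForm KC (linearForm zD P) = C n * ((∑ j, C (α j) * X (Sum.inl j)) ^ 2 -
        C κ * (∑ j, C (β j) * X (Sum.inr j)) ^ 2) := by
  have hdeg : Module.finrank KB KD = 6 := by
    have : FiniteDimensional KB KC := FiniteDimensional.of_finrank_pos (by omega)
    rw [← Module.finrank_mul_finrank KB KC KD, hf, hg]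
  have hli := linearIndependent_aeval_generator (K := KB) zD hdeg (by norm_num) (by simp) P
  obtain ⟨c, hc, hcp, hcm⟩ := hP
  set p : Idx → KD := fun i => Polynomial.aeval (zD RatFunc.X) (P i : Polynomial k) with hp
  change ∀ i, ιD (p (Sum.inl i)) = c * p (Sum.inl i) at hcp
  change ∀ i, ιD (p (Sum.inr i)) = -(c * p (Sum.inr i)) at hcm
  -- Dividing by one reference coordinate of each sign cancels the factor `c`. Ratios within a sign
  -- therefore lie in `KC`, while `θ = B / A` is anti-invariant.
  obtain ⟨A, hA⟩ : ∃ A, p (Sum.inl 0) = A := ⟨_, rfl⟩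
  obtain ⟨B, hB⟩ : ∃ B, p (Sum.inr 0) = B := ⟨_, rfl⟩
  have hA0 : A ≠ 0 := hA ▸ hli.ne_zero (Sum.inl 0)
  have hB0 : B ≠ 0 := hB ▸ hli.ne_zero (Sum.inr 0)
  have hιA : ιD A = c * A := hA ▸ hcp 0
  have hιB : ιD B = -(c * B) := hB ▸ hcm 0
  have hθ0 : B / A ≠ 0 := div_ne_zero hB0 hA0
  have hθ : ιD (B / A) = -(B / A) := by
    rw [map_div₀, hιA, hιB]
    field_simp
  obtain ⟨κ, hκ⟩ := mem_range_algebraMap_of_fixed h2 hg ιD hθ0 hθ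
    (x := (B / A) ^ 2) (by rw [map_pow, hθ, neg_sq])
  obtain ⟨α, hα⟩ := exists_basis_of_mul_eq hf (A := A) (hli.comp _ Sum.inl_injective) (fun j => by
    obtain ⟨a, ha⟩ := mem_range_algebraMap_of_fixed h2 hg ιD hθ0 hθ
      (x := p (Sum.inl j) / A) (by rw [map_div₀, hcp, hιA, mul_div_mul_left _ _ hc])
    exact ⟨a, by rw [ha, div_mul_cancel₀ _ hA0]; rfl⟩)
  obtain ⟨β, hβ⟩ := exists_basis_of_mul_eq hf (A := B) (hli.comp _ Sum.inr_injective) (fun j => by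
    obtain ⟨a, ha⟩ := mem_range_algebraMap_of_fixed h2 hg ιD hθ0 hθ
      (x := p (Sum.inr j) / B)
      (by rw [map_div₀, hcm, hιB, neg_div_neg_eq, mul_div_mul_left _ _ hc])
    exact ⟨a, by rw [ha, div_mul_cancel₀ _ hB0]; rfl⟩)
  obtain ⟨b, hb0, hb1⟩ := exists_basis_one_sqrt h2 hg ιD hθ0 hθ
  have hκ' : b 1 ^ 2 = algebraMap KC KD κ := by rw [hb1, hκ]
  obtain ⟨n, hn⟩ : ∃ n, Algebra.norm (MvPolynomial Idx KC) (C A : MvPolynomial Idx KD) = C n := by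
    have hs := b.sum_repr A
    rw [Fin.sum_univ_two, hb0, Algebra.smul_def, Algebra.smul_def, mul_one] at hs
    refine ⟨b.repr A 0 ^ 2 - κ * b.repr A 1 ^ 2, ?_⟩
    have h := norm_add_mul_sqrt (σ := Idx) b hb0 κ hκ' (C (b.repr A 0)) (C (b.repr A 1))
    rw [map_C, map_C, ← C_mul, ← C_add, mul_comm (b 1), hs] at h
    simpa using h
  refine ⟨B / A, κ, n, α, β, hθ, hκ.symm, ?_, ?_, ?_⟩
  · rintro rfl
    rw [map_zero] at hκ
    exact hθ0 (pow_eq_zero_iff two_ne_zero |>.1 hκ.symm)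
  · rintro rfl
    have h : Algebra.norm (MvPolynomial Idx KC) (C A * C A⁻¹ : MvPolynomial Idx KD) = 0 := by
      rw [map_mul, hn, C_0, zero_mul]
    rw [← C_mul, mul_inv_cancel₀ hA0, C_1, map_one] at h
    exact one_ne_zero h
  · have hJ : linearForm zD P = C A * (map (algebraMap KC KD) (∑ j, C (α j) * X (Sum.inl j)) +
        C (b 1) * map (algebraMap KC KD) (∑ j, C (β j) * X (Sum.inr j))) := by
      rw [hb1]
      exact sum_C_mul_X_eq p hα fun j => by rw [mul_div_cancel₀ _ hA0, hβ]; rfl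
    rw [normForm, hJ, map_mul, hn, norm_add_mul_sqrt b hb0 κ hκ']

end Diagonal

end EnriquesPencil

/-! ### The dichotomy for points and a point of degree `3` -/

open EnriquesPencil in
theorem proposition3p1 {k : Type u} [Field k] (h2 : (2 : k) ≠ 0) (h3 : (3 : k) ≠ 0)
    -- the function fields `k(B) ⊆ k(C) ⊆ k(D)` of the tower `D → C → B`
    {KB KC KD : Type u} [Field KB] [Field KC] [Field KD]
    [Algebra k KB] [Algebra k KC] [Algebra k KD] [Algebra KB KC] [Algebra KC KD] [Algebra KB KD]
    [IsScalarTower k KB KC] [IsScalarTower k KC KD] [IsScalarTower KB KC KD]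
    -- `B`, `C`, `D` are isomorphic to the projective line over `k`
    (hB : Nonempty (RatFunc k ≃ₐ[k] KB)) (hC : Nonempty (RatFunc k ≃ₐ[k] KC))
    (zD : RatFunc k ≃ₐ[k] KD)
    -- `f : C → B` and `g : D → C` are separable of degrees 3 and 2
    (hf : Module.finrank KB KC = 3) (hfs : Algebra.IsSeparable KB KC)
    (hg : Module.finrank KC KD = 2) (hgs : Algebra.IsSeparable KC KD)
    -- the Galois group of the Galois closure of `k(D)` over `k(B)` is the full wreath product
    (hGal : Nonempty (Gal(IntermediateField.normalClosure KB KD (AlgebraicClosure KD)/KB) ≃*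
      WreathProduct))
    -- the involution of `D` over `C`, and an equivariant rational normal curve of degree 5
    (ιD : KD ≃ₐ[KC] KD) (hι : ιD ≠ 1)
    (P : Module.Basis Idx k (Polynomial.degreeLT k 6)) (hP : IsEquivariant zD P ιD) :
    (∀ T : IrreducibleMultisection (net KB (normForm KC (linearForm zD P))),
      3 ∣ T.degree ∨ 4 ∣ T.degree) ∧
    IsLeast (pointDegrees (net KB (normForm KC (linearForm zD P)))) 3 := by
  have : IsScalarTower k KB KD := .of_algebraMap_eq fun x => by
    rw [IsScalarTower.algebraMap_apply k KC KD, IsScalarTower.algebraMap_apply k KB KC,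
      ← IsScalarTower.algebraMap_apply KB KC KD]
  have : FiniteDimensional KB KC := FiniteDimensional.of_finrank_pos (by omega)
  have : FiniteDimensional KC KD := FiniteDimensional.of_finrank_pos (by omega)
  have : FiniteDimensional KB KD := FiniteDimensional.trans KB KC KD
  have : Algebra.IsSeparable KB KD := Algebra.IsSeparable.trans KB KC KD
  let Ω := AlgebraicClosure KD
  have : IsAlgClosure KB Ω := ⟨inferInstance, Algebra.IsAlgebraic.trans KB KD Ω⟩
  have h2D : (2 : KD) ≠ 0 := by
    rw [← map_ofNat (algebraMap k KD) 2]
    exact (map_ne_zero _).2 h2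
  have h2Ω : (2 : Ω) ≠ 0 := by
    rw [← map_ofNat (algebraMap KD Ω) 2]
    exact (map_ne_zero _).2 h2D
  have hcardC : Nat.card (KC →ₐ[KB] Ω) = 3 := by
    rw [Nat.card_eq_fintype_card, AlgHom.card, hf]
  have hcardD : Nat.card (KD →ₐ[KB] Ω) = 6 := by
    rw [Nat.card_eq_fintype_card, AlgHom.card, ← Module.finrank_mul_finrank KB KC KD, hf, hg]
  have hN : Nat.card Gal(IntermediateField.normalClosure KB KD Ω/KB) = 48 :=
    (Nat.card_congr hGal.some.toEquiv).trans card_wreathProduct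
  obtain ⟨θ, κ, n, α, β, hθ, hκ, hκ0, hn, hQ⟩ :=
    exists_normForm_eq_diagonal (KB := KB) h2D zD hf hg ιD P hP
  rw [hQ]
  -- Here `L` need not be the field of definition of the point, so the same claim serves for
  -- multi-sections and for the minimum.
  have key (L : Type u) [Field L] [Algebra KB L] [FiniteDimensional KB L] (p : ZPoint L)
      (hp : p ∈ XPoints (net KB (MvPolynomial.C n *
        ((∑ j, MvPolynomial.C (α j) * MvPolynomial.X (Sum.inl j)) ^ 2 -
        MvPolynomial.C κ * (∑ j, MvPolynomial.C (β j) * MvPolynomial.X (Sum.inr j)) ^ 2))) L) :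
      3 ∣ Module.finrank KB L ∨ 4 ∣ Module.finrank KB L := by
    obtain ⟨x, -, hx⟩ := hp
    have hX : ∀ (φ : L →ₐ[KB] Ω) (i : KC →ₐ[KB] Ω), φ x.s * formValue α x.xp φ i ^ 2 =
        φ x.t * (i κ * formValue β x.xm φ i ^ 2) := by
      intro φ i
      have h := (forall_mem_net_eval_eq_zero_iff _ x φ).1 hx i
      rw [conjEval_diagonal] at h
      exact sub_eq_zero.1 ((mul_eq_zero.1 h).resolve_left ((map_ne_zero i).2 hn))
    have hzero : ∀ (b : Module.Basis (Fin 3) KB KC) (y : Fin 3 → L), y ≠ 0 →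
        ∀ φ : L →ₐ[KB] Ω, ∃ i : KC →ₐ[KB] Ω, formValue b y φ i ≠ 0 := by
      intro b y hy φ
      by_contra! h
      have h1 := eq_zero_of_forall_sum_embeddings b (fun j => φ (y j)) h
      exact hy (funext fun j => (map_eq_zero φ).1 (congrFun h1 j))
    -- If `s = 0`, then `t ≠ 0` and all `Bᵢ` vanish, which contradicts `xm ≠ 0`.
    have hs : x.s ≠ 0 := by
      intro hs
      let φ : L →ₐ[KB] Ω := IsAlgClosed.lift
      obtain ⟨i, hi⟩ := hzero β x.xm x.xm_ne φ
      have h := hX φ i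
      rw [hs, map_zero, zero_mul] at h
      exact mul_ne_zero ((map_ne_zero φ).2 (x.st_ne.resolve_left (not_not.2 hs)))
        (mul_ne_zero ((map_ne_zero i).2 hκ0) (pow_ne_zero 2 hi)) h.symm
    by_cases hex : ∃ (φ : L →ₐ[KB] Ω) (i : KC →ₐ[KB] Ω), formValue α x.xp φ i = 0
    · exact Or.inl (three_dvd_finrank hcardC α x.xp (hzero α x.xp x.xp_ne) hex)
    · push Not at hex
      exact Or.inr (four_dvd_finrank h2Ω hcardC hcardD hN ιD hι
        (involutive_of_finrank_eq_two hg ιD hι) θ hθ κ hκ α β x.xp x.xm x.s x.t hs hX hex)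
  refine ⟨fun T => key T.L T.point T.mem, ?_, ?_⟩
  · classical
    -- At the conjugate of this point by `φ`, both `Aᵢ` and `Bᵢ` are `1` for `i = φ` and `0`
    -- otherwise. The only remaining equation is `s = t κ`.
    let x : ZCoord KC :=
      { xp := α.traceDual
        xm := β.traceDual
        s := κ
        t := 1
        xp_ne := fun h => α.traceDual.ne_zero 0 (congrFun h 0)
        xm_ne := fun h => β.traceDual.ne_zero 0 (congrFun h 0)
        st_ne := Or.inl hκ0 }
    refine ⟨KC, inferInstance, inferInstance, inferInstance, ⟨⟦x⟧, x, rfl, ?_⟩, hf⟩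
    let φ : KC →ₐ[KB] Ω := IsAlgClosed.lift
    rw [forall_mem_net_eval_eq_zero_iff _ x φ]
    intro i
    rw [conjEval_diagonal]
    have hα : formValue α x.xp φ i = if i = φ then 1 else 0 := sum_basis_mul_traceDual α i φ
    have hβ : formValue β x.xm φ i = if i = φ then 1 else 0 := sum_basis_mul_traceDual β i φ
    rw [hα, hβ]
    by_cases h : i = φ
    · subst h
      simp [x]
    · simp [h]
  · rintro m ⟨L, _, _, _, ⟨p, hp⟩, rfl⟩
    have hpos : 0 < Module.finrank KB L := Module.finrank_pos
    rcases key L p hp with h | h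
    · exact Nat.le_of_dvd hpos h
    · exact (by norm_num : 3 ≤ 4).trans (Nat.le_of_dvd hpos h)
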